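/- Let $A\in\mathbb{R}^{m\times n}$ have rank $m$, let $b\in\mathbb{R}^m$, and let $K_n:=\{x\in\mathbb{R}^n : x_1,\dots,x_n\ge 0,\ Ax=b\}$. Assume that $K_n$ is compact and that it has non-empty interior relative to the affine subspace $\{x\in\mathbb{R}^n: Ax=b\}$. Let $w=(w_1,\dots,w_n)$ be any vector in the row span of $A$ with $w_j>0$ for all $j$, and let $P_{n,w}$ be the probability distribution on $\mathbb{R}^n$ with Lebesgue density $$\Big(\prod_{j=1}^n w_j\Big)\,e^{-\sum_{j=1}^n w_jx_j}\,\mathbf 1_{\{x_1,\dots,x_n\ge 0\}}(x).$$ Write $A_{\bullet j}\in\mathbb{R}^m$ for the $j$-th column of $A$. Then the following statements are equivalent: 1. The function $\eta\mapsto \mathbb{E}_{P_{n,w}}\, e^{i\sum_{j=1}^n\langle\eta,A_{\bullet j}\rangle X_j}$, where $X=(X_1,\dots,X_n)$ has distribution $P_{n,w}$, is in $L^1(\mathbb{R}^m,d\eta)$. 2. The rank of $A$ cannot be reduced by removing one column: for every $j=1,\dots,n$, the matrix obtained from $A$ by removing its $j$-th column has the same rank as $A$. 3. For every $j=1,\dots,n$,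 the projection $\{x_j : x\in K_n\}\subset\mathbb{R}$ of $K_n$ onto the $j$-th coordinate has non-empty interior in $\mathbb{R}$. -/

import Mathlib

open MeasureTheory Matrix

noncomputable section

/-- The polytope `K = {x ∈ ℝⁿ : x ≥ 0, A x = b}`. -/
def polytope {m n : ℕ} (A : Matrix (Fin m) (Fin n) ℝ) (b : Fin m → ℝ) : Set (Fin n → ℝ) :=
  {x | (∀ j, 0 ≤ x j) ∧ A *ᵥ x = b}

/-- The interior of the polytope `K` relative to the affine subspace `{x ∈ ℝⁿ : A x = b}`, as a
subset of that affine subspace (with the subspace topology). -/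
def polytopeRelInterior {m n : ℕ} (A : Matrix (Fin m) (Fin n) ℝ) (b : Fin m → ℝ) :
    Set {x : Fin n → ℝ // A *ᵥ x = b} :=
  interior {x | (x : Fin n → ℝ) ∈ polytope A b}

/-- The measure `P_w` on `ℝⁿ` with Lebesgue density
`(∏ j, w j) * exp (-∑ j, w j * x j)` on the orthant `x ≥ 0`, and `0` elsewhere. -/
def expProductLaw {n : ℕ} (w : Fin n → ℝ) : Measure (Fin n → ℝ) :=
  (volume : Measure (Fin n → ℝ)).withDensity
    (Set.indicator {x | ∀ j, 0 ≤ x j}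
      (fun x => ENNReal.ofReal ((∏ j, w j) * Real.exp (-∑ j, w j * x j))))

/-- The function `η ↦ E_{P_w} exp (i ∑ j, ⟨η, A_{•j}⟩ X_j)` on `ℝᵐ`, where `A_{•j}` is the
`j`-th column of `A`. -/
def constraintCharFun {m n : ℕ} (A : Matrix (Fin m) (Fin n) ℝ) (w : Fin n → ℝ)
    (η : Fin m → ℝ) : ℂ :=
  ∫ x, Complex.exp (Complex.I * ((∑ j, (η ⬝ᵥ fun l => A l j) * x j : ℝ) : ℂ))
    ∂(expProductLaw w)

/-- The matrix obtained from `A` by removing its `j`-th column. -/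
def removeCol {m n : ℕ} (A : Matrix (Fin m) (Fin n) ℝ) (j : Fin n) :
    Matrix (Fin m) {k : Fin n // k ≠ j} ℝ :=
  A.submatrix id (fun k => (k : Fin n))

end

/-! The coordinates are independent exponentials, so the characteristic function is a product over
the columns whose `j`-th factor has modulus `expCharNorm (w j)` at `⟨η, A_{•j}⟩`. This decays like
`1/|t|`: just not integrable, but integrable when raised to any power above 1.

If every column is removable, then for each `k` some `m` columns avoiding `k` form a basis. A
geometric mean over these `n` bases (`prod_le_sum_prod_rpow`) raises the exponent to `n / (n - 1) >
1`, and a linear change of variables finishes. If column `j` is essential, some direction `u` is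
orthogonal to all the other columns; moving along `u` changes one factor only, and the integral
diverges like the harmonic series (`not_integrable_prod_expCharNorm`).

Statements 2 and 3 both say, for each `j`, that the kernel of `A` contains a vector with nonzero
`j`-th entry. -/

/-! ### The characteristic function in closed form -/

/-- The modulus of the characteristic function of the exponential law of rate `c`. -/
noncomputable def expCharNorm (c t : ℝ) : ℝ := c / √(c ^ 2 + t ^ 2)

theorem expCharNorm_pos {c : ℝ} (hc : 0 < c) (t : ℝ) : 0 < expCharNorm c t := by
  unfold expCharNorm; positivity

theorem expCharNorm_le_one {c : ℝ} (hc : 0 < c) (t : ℝ) : expCharNorm c t ≤ 1 := by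
  unfold expCharNorm
  rw [div_le_one (by positivity)]
  exact Real.le_sqrt_of_sq_le (by nlinarith [sq_nonneg t])

theorem continuous_expCharNorm {c : ℝ} (hc : 0 < c) : Continuous (expCharNorm c) := by
  unfold expCharNorm
  exact continuous_const.div (by fun_prop) fun t => by positivity

theorem integral_exponential_mul_cexp {c : ℝ} (hc : 0 < c) (t : ℝ) :
    ∫ x : ℝ, Set.indicator (Set.Ici 0)
      (fun x : ℝ => (c : ℂ) * Complex.exp ((-c + Complex.I * t) * x)) x
      = c / (c - Complex.I * t) := by
  rw [integral_indicator measurableSet_Ici, integral_Ici_eq_integral_Ioi,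
    integral_const_mul, integral_exp_mul_complex_Ioi (by simpa using hc)]
  have h : -(c : ℂ) + Complex.I * t = -(c - Complex.I * t) := by ring
  rw [h, Complex.ofReal_zero, mul_zero, Complex.exp_zero, neg_div_neg_eq, mul_one_div]

theorem constraintCharFun_eq {m n : ℕ} (A : Matrix (Fin m) (Fin n) ℝ) {w : Fin n → ℝ}
    (hw : ∀ j, 0 < w j) (η : Fin m → ℝ) :
    constraintCharFun A w η
      = ∏ j, ((w j : ℂ) / (w j - Complex.I * ((η ⬝ᵥ fun l => A l j : ℝ) : ℂ))) := by
  have hmeas : MeasurableSet {x : Fin n → ℝ | ∀ j, 0 ≤ x j} := by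
    simp only [Set.ofPred_forall]
    exact MeasurableSet.iInter fun j => measurableSet_le measurable_const (measurable_pi_apply j)
  have hW : 0 ≤ ∏ j, w j := Finset.prod_nonneg fun j _ => (hw j).le
  unfold constraintCharFun expProductLaw
  rw [integral_withDensity_eq_integral_toReal_smul
    (Measurable.indicator (by fun_prop) hmeas)
    (Filter.Eventually.of_forall fun x => by
      by_cases hx : x ∈ {x : Fin n → ℝ | ∀ j, 0 ≤ x j} <;> simp [Set.indicator, hx])]
  simp_rw [← fun j => integral_exponential_mul_cexp (hw j) (η ⬝ᵥ fun l => A l j)]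
  rw [← integral_fintype_prod_volume_eq_prod]
  refine integral_congr_ae (Filter.Eventually.of_forall fun x => ?_)
  by_cases hx : ∀ j, 0 ≤ x j
  · have h1 : ∀ j, x j ∈ Set.Ici (0 : ℝ) := hx
    have h2 : x ∈ {x : Fin n → ℝ | ∀ j, 0 ≤ x j} := hx
    simp only [Set.indicator_of_mem h2, Set.indicator_of_mem (h1 _)]
    rw [ENNReal.toReal_ofReal (by positivity), Finset.prod_mul_distrib, ← Complex.exp_sum,
      Complex.real_smul]
    push_cast
    rw [mul_assoc, ← Complex.exp_add, ← Finset.sum_neg_distrib, Finset.mul_sum,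
      ← Finset.sum_add_distrib]
    congr 2
    exact Finset.sum_congr rfl fun j _ => by ring
  · have h2 : x ∉ {x : Fin n → ℝ | ∀ j, 0 ≤ x j} := hx
    obtain ⟨j, hj⟩ := not_forall.1 hx
    have h1 : x j ∉ Set.Ici (0 : ℝ) := hj
    refine Eq.trans ?_ (Finset.prod_eq_zero (Finset.mem_univ j)
      (Set.indicator_of_notMem h1 _)).symm
    simp [Set.indicator_of_notMem h2]

theorem sub_I_mul_ne_zero {c : ℝ} (hc : 0 < c) (t : ℝ) : (c : ℂ) - Complex.I * t ≠ 0 := by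
  intro h
  have := congrArg Complex.re h
  simp at this
  exact hc.ne' this

theorem norm_div_sub_I_mul {c : ℝ} (hc : 0 < c) (t : ℝ) :
    ‖(c : ℂ) / (c - Complex.I * t)‖ = expCharNorm c t := by
  rw [norm_div, Complex.norm_real, Real.norm_of_nonneg hc.le, expCharNorm, Complex.norm_def,
    Complex.normSq_apply]
  simp [sq]

theorem integrable_constraintCharFun_iff {m n : ℕ} (A : Matrix (Fin m) (Fin n) ℝ) {w : Fin n → ℝ}
    (hw : ∀ j, 0 < w j) :
    Integrable (constraintCharFun A w) (volume : Measure (Fin m → ℝ)) ↔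
      Integrable (fun η : Fin m → ℝ => ∏ j, expCharNorm (w j) (η ⬝ᵥ fun l => A l j)) volume := by
  have hcont : Continuous (constraintCharFun A w) := by
    rw [funext (constraintCharFun_eq A hw)]
    refine continuous_finsetProd _ fun j _ => continuous_const.div ?_
      fun η => sub_I_mul_ne_zero (hw j) _
    unfold dotProduct
    fun_prop
  rw [← integrable_norm_iff hcont.aestronglyMeasurable]
  simp_rw [constraintCharFun_eq A hw, norm_prod, norm_div_sub_I_mul (hw _)]

/-! ### Columns that can be removed without lowering the rank -/

theorem rank_removeCol_eq_iff_mem_span {m n : ℕ} (A : Matrix (Fin m) (Fin n) ℝ) (j : Fin n) :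
    (removeCol A j).rank = A.rank ↔
      A.col j ∈ Submodule.span ℝ (Set.range (removeCol A j).col) := by
  have hle : Submodule.span ℝ (Set.range (removeCol A j).col)
      ≤ Submodule.span ℝ (Set.range A.col) :=
    Submodule.span_mono (by rintro _ ⟨k, rfl⟩; exact ⟨k, rfl⟩)
  rw [rank_eq_finrank_span_cols, rank_eq_finrank_span_cols]
  constructor
  · intro h
    rw [Submodule.eq_of_le_of_finrank_eq hle h]
    exact Submodule.subset_span ⟨j, rfl⟩
  · intro h
    suffices heq : Submodule.span ℝ (Set.range (removeCol A j).col)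
        = Submodule.span ℝ (Set.range A.col) by rw [heq]
    refine le_antisymm hle (Submodule.span_le.2 ?_)
    rintro _ ⟨k, rfl⟩
    by_cases hk : k = j
    · subst hk; exact h
    · exact Submodule.subset_span ⟨⟨k, hk⟩, rfl⟩

/-- A relation writing column `j` through the others is a kernel vector, normalised to have entry
`-1` at `j`. -/
theorem rank_removeCol_eq_iff_exists_ker {m n : ℕ} (A : Matrix (Fin m) (Fin n) ℝ) (j : Fin n) :
    (removeCol A j).rank = A.rank ↔ ∃ v : Fin n → ℝ, A *ᵥ v = 0 ∧ v j ≠ 0 := by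
  rw [rank_removeCol_eq_iff_mem_span, Submodule.mem_span_range_iff_exists_fun]
  have hsplit : ∀ v : Fin n → ℝ, A *ᵥ v
      = v j • A.col j + ∑ k : {k : Fin n // k ≠ j}, v k • (removeCol A j).col k := by
    intro v
    rw [mulVec_eq_sum, Fintype.sum_eq_add_sum_subtype_ne _ j]
    simp only [op_smul_eq_smul]
    rfl
  constructor
  · rintro ⟨c, hc⟩
    refine ⟨fun k => if h : k = j then -1 else c ⟨k, h⟩, ?_, by simp⟩
    rw [hsplit, ← hc]
    simp only [dite_true, neg_smul, one_smul, neg_add_eq_zero]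
    exact Finset.sum_congr rfl fun k _ => by rw [dif_neg k.2]
  · rintro ⟨v, hv, hj⟩
    refine ⟨fun k => -(v j)⁻¹ * v k, ?_⟩
    simp_rw [mul_smul, ← Finset.smul_sum]
    rw [hsplit, add_comm] at hv
    rw [eq_neg_of_add_eq_zero_left hv, smul_neg, neg_smul, neg_neg, smul_smul,
      inv_mul_cancel₀ hj, one_smul]

/-! ### Coordinate projections of the polytope -/

theorem nonempty_interior_image_polytope_iff {m n : ℕ} (A : Matrix (Fin m) (Fin n) ℝ)
    (b : Fin m → ℝ) (hrelint : (polytopeRelInterior A b).Nonempty) (j : Fin n) :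
    (interior ((fun x : Fin n → ℝ => x j) '' polytope A b)).Nonempty ↔
      ∃ v : Fin n → ℝ, A *ᵥ v = 0 ∧ v j ≠ 0 := by
  constructor
  · rintro ⟨r, hr⟩
    obtain ⟨ε, hε, hball⟩ := Metric.isOpen_iff.1 isOpen_interior r hr
    obtain ⟨x, hx, hxr⟩ := interior_subset hr
    obtain ⟨y, hy, hyr⟩ := interior_subset (hball (show r + ε / 2 ∈ Metric.ball r ε by
      simp [abs_of_pos hε]; linarith))
    refine ⟨y - x, by rw [mulVec_sub, hx.2, hy.2, sub_self], ?_⟩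
    simp only at hxr hyr
    rw [Pi.sub_apply, hxr, hyr]
    linarith
  · rintro ⟨v, hv, hj⟩
    obtain ⟨⟨x, hx⟩, hxint⟩ := hrelint
    -- A line through `x` inside the affine subspace, parametrised by its `j`-th coordinate: the
    -- preimage of the relative interior is then an open set inside the projection.
    let γ : ℝ → {x : Fin n → ℝ // A *ᵥ x = b} := fun r => ⟨x + ((r - x j) / v j) • v, by
      rw [mulVec_add, mulVec_smul, hv, smul_zero, add_zero, hx]⟩
    have hγ : Continuous γ := by
      refine Continuous.subtype_mk ?_ _
      fun_prop
    have hγ0 : γ (x j) = ⟨x, hx⟩ := by simp [γ]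
    refine ⟨x j, mem_interior.2 ⟨γ ⁻¹' polytopeRelInterior A b, ?_,
      isOpen_interior.preimage hγ, by rw [Set.mem_preimage, hγ0]; exact hxint⟩⟩
    intro r hr
    refine ⟨(γ r : Fin n → ℝ), interior_subset (s := {y : {x : Fin n → ℝ // A *ᵥ x = b} |
      (y : Fin n → ℝ) ∈ polytope A b}) hr, ?_⟩
    simp only [γ, Pi.add_apply, Pi.smul_apply, smul_eq_mul]
    field_simp
    ring

/-! ### Integrability when every column is removable -/

theorem integrable_expCharNorm_rpow {c : ℝ} (hc : 0 < c) {q : ℝ} (hq : 1 < q) :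
    Integrable (fun t => expCharNorm c t ^ q) := by
  have h := (integrable_rpow_neg_one_add_norm_sq (E := ℝ) (μ := volume) (r := q)
    (by simpa using hq)).comp_div hc.ne'
  refine h.congr (Filter.Eventually.of_forall fun t => ?_)
  have h1 : c ^ 2 + t ^ 2 = c ^ 2 * (1 + ‖t / c‖ ^ 2) := by
    rw [Real.norm_eq_abs, sq_abs]; field_simp
  have h2 : expCharNorm c t = (1 + ‖t / c‖ ^ 2) ^ (-(1 / 2) : ℝ) := by
    rw [expCharNorm, h1, Real.sqrt_mul (sq_nonneg c), Real.sqrt_sq hc.le,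
      Real.rpow_neg (by positivity), ← Real.sqrt_eq_rpow]
    field_simp
  simp only [h2]
  rw [← Real.rpow_mul (by positivity)]
  congr 1
  ring

theorem integrable_prod_comp_mulVec {m : ℕ} {M : Matrix (Fin m) (Fin m) ℝ} (hM : M.det ≠ 0)
    {F : Fin m → ℝ → ℝ} (hF : ∀ i, Integrable (F i)) :
    Integrable (fun η : Fin m → ℝ => ∏ i, F i ((M *ᵥ η) i)) := by
  have h := (Integrable.fintype_prod hF).smul_measure
    (c := ENNReal.ofReal |M.det⁻¹|) ENNReal.ofReal_ne_top
  rw [← volume_pi, ← Real.map_matrix_volume_pi_eq_smul_volume_pi hM] at h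
  exact h.comp_measurable (by fun_prop)

theorem exists_basis_of_rank_removeCol {m n : ℕ} {A : Matrix (Fin m) (Fin n) ℝ} {k : Fin n}
    (hk : (removeCol A k).rank = m) :
    ∃ B : Fin m → Fin n, Function.Injective B ∧ (∀ i, B i ≠ k) ∧
      (Matrix.of fun i l => A l (B i)).det ≠ 0 := by
  obtain ⟨κ, a, ha, hspan, hli⟩ := exists_linearIndependent' ℝ (removeCol A k).col
  have : Fintype κ := Fintype.ofInjective a ha
  have hcard : Fintype.card κ = m := by
    rw [← finrank_span_eq_card hli, hspan, ← rank_eq_finrank_span_cols, hk]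
  let e : Fin m ≃ κ := (Fintype.equivFinOfCardEq hcard).symm
  refine ⟨fun i => a (e i), fun i j h => e.injective (ha (Subtype.ext h)),
    fun i => (a (e i)).2, ?_⟩
  have hli' := hli.comp e e.injective
  exact ((isUnit_iff_isUnit_det _).1 (linearIndependent_rows_iff_isUnit.1 hli')).ne_zero

/-- If every index is missed by one of the injections `B k`, a product of numbers in `(0, 1]` is
at most the average of powers, with exponent `n / (n - 1)`, of the products along the `B k`. -/
theorem prod_le_sum_prod_rpow {m n : ℕ} (hn : 2 ≤ n) {f : Fin n → ℝ} (hf0 : ∀ j, 0 < f j)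
    (hf1 : ∀ j, f j ≤ 1) {B : Fin n → Fin m → Fin n} (hinj : ∀ k, Function.Injective (B k))
    (hB : ∀ k i, B k i ≠ k) :
    ∏ j, f j ≤ ∑ k, (1 / n : ℝ) * ∏ i, f (B k i) ^ ((n : ℝ) / (n - 1)) := by
  have hn' : (2 : ℝ) ≤ n := by exact_mod_cast hn
  set H := ∏ j, f j with hH
  have hH0 : 0 < H := Finset.prod_pos fun j _ => hf0 j
  have hP0 : ∀ k, 0 < ∏ i, f (B k i) := fun k => Finset.prod_pos fun i _ => hf0 _
  have hP : ∀ k, H / f k ≤ ∏ i, f (B k i) := by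
    intro k
    have h1 : H / f k = ∏ j ∈ Finset.univ.erase k, f j := by
      rw [div_eq_iff (hf0 k).ne', Finset.prod_erase_mul _ _ (Finset.mem_univ k)]
    have h2 : ∏ i, f (B k i) = ∏ j ∈ Finset.univ.image (B k), f j :=
      (Finset.prod_image fun i _ j _ h => hinj k h).symm
    rw [h1, h2]
    have hsub : Finset.univ.image (B k) ⊆ Finset.univ.erase k := fun j hj => by
      obtain ⟨i, -, rfl⟩ := Finset.mem_image.1 hj
      exact Finset.mem_erase.2 ⟨hB k i, Finset.mem_univ _⟩
    rw [← Finset.prod_sdiff hsub]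
    exact mul_le_of_le_one_left (Finset.prod_nonneg fun j _ => (hf0 j).le)
      (Finset.prod_le_one (fun j _ => (hf0 j).le) fun j _ => hf1 j)
  -- Each `f j` is omitted from exactly one of the quotients `H / f k`, so their product is `H ^ n /
  -- H`.
  have hprod : H ^ ((n : ℝ) - 1) ≤ ∏ k, ∏ i, f (B k i) := by
    calc H ^ ((n : ℝ) - 1) = ∏ k, H / f k := by
          rw [Finset.prod_div_distrib, Finset.prod_const, Finset.card_univ, Fintype.card_fin,
            Real.rpow_sub_one hH0.ne', Real.rpow_natCast]
      _ ≤ _ := Finset.prod_le_prod (fun k _ => (div_pos hH0 (hf0 k)).le) fun k _ => hP k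
  calc H = (H ^ ((n : ℝ) - 1)) ^ (1 / ((n : ℝ) - 1)) := by
        rw [← Real.rpow_mul hH0.le, mul_one_div_cancel (by linarith), Real.rpow_one]
    _ ≤ (∏ k, ∏ i, f (B k i)) ^ (1 / ((n : ℝ) - 1)) :=
        Real.rpow_le_rpow (by positivity) hprod (by
          apply one_div_nonneg.2; linarith)
    _ = ∏ k, (∏ i, f (B k i) ^ ((n : ℝ) / (n - 1))) ^ (1 / n : ℝ) := by
        rw [← Real.finsetProd_rpow _ _ fun k _ => (hP0 k).le]
        refine Finset.prod_congr rfl fun k _ => ?_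
        rw [Real.finsetProd_rpow _ _ fun i _ => (hf0 _).le, ← Real.rpow_mul (hP0 k).le]
        congr 1
        field_simp
    _ ≤ _ := Real.geom_mean_le_arith_mean_weighted _ _ _ (fun k _ => by positivity)
        (by simp; field_simp)
        (fun k _ => Finset.prod_nonneg fun i _ => Real.rpow_nonneg (hf0 _).le _)

theorem integrable_prod_expCharNorm {m n : ℕ} {A : Matrix (Fin m) (Fin n) ℝ} {w : Fin n → ℝ}
    (hw : ∀ j, 0 < w j) (hrank : A.rank = m) (h : ∀ j, (removeCol A j).rank = A.rank) :
    Integrable (fun η : Fin m → ℝ => ∏ j, expCharNorm (w j) (η ⬝ᵥ fun l => A l j)) volume := by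
  obtain rfl | hm := Nat.eq_zero_or_pos m
  · exact Integrable.of_finite
  -- Removing a column leaves rank `m ≥ 1`, so at least one other column remains; this makes `n / (n
  -- - 1)` meaningful.
  have hn : 2 ≤ n := by
    by_contra! hlt
    have hmn : m ≤ n := by simpa [hrank] using A.rank_le_width
    have hle := (removeCol A ⟨0, by omega⟩).rank_le_card_width
    rw [h, hrank] at hle
    simp at hle
    omega
  have hn' : (2 : ℝ) ≤ n := by exact_mod_cast hn
  choose B hinj hB hdet using fun k => exists_basis_of_rank_removeCol ((h k).trans hrank)
  have hcont : Continuous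
      fun η : Fin m → ℝ => ∏ j, expCharNorm (w j) (η ⬝ᵥ fun l => A l j) := by
    refine continuous_finsetProd _ fun j _ => (continuous_expCharNorm (hw j)).comp ?_
    unfold dotProduct
    fun_prop
  refine Integrable.mono' (g := fun η => ∑ k, (1 / n : ℝ) * ∏ i,
      expCharNorm (w (B k i)) (η ⬝ᵥ fun l => A l (B k i)) ^ ((n : ℝ) / (n - 1))) ?_
    hcont.aestronglyMeasurable (Filter.Eventually.of_forall fun η => ?_)
  · refine integrable_finsetSum _ fun k _ => Integrable.const_mul ?_ _
    have := integrable_prod_comp_mulVec (hdet k) fun i =>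
      integrable_expCharNorm_rpow (hw (B k i)) (q := (n : ℝ) / (n - 1))
        (by rw [lt_div_iff₀ (by linarith)]; linarith)
    refine this.congr (Filter.Eventually.of_forall fun η => ?_)
    refine Finset.prod_congr rfl fun i _ => ?_
    rw [dotProduct_comm]
    rfl
  · rw [Real.norm_of_nonneg (Finset.prod_nonneg fun j _ => (expCharNorm_pos (hw j) _).le)]
    exact prod_le_sum_prod_rpow hn (fun j => expCharNorm_pos (hw j) _)
      (fun j => expCharNorm_le_one (hw j) _) hinj hB

/-! ### Divergence along the direction dual to an essential column -/

/-- Since `s < 1`, the denominator at `s + N` is at most `c + N + 1`. The factor at `s`, at most 1,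
is kept so that the bound integrates against the full product. -/
theorem mul_expCharNorm_le_add {c : ℝ} (hc : 0 < c) {s : ℝ} (hs0 : 0 ≤ s) (hs1 : s < 1) (N : ℕ) :
    c / (c + N + 1) * expCharNorm c s ≤ expCharNorm c (s + N) := by
  have hN : (0 : ℝ) ≤ N := N.cast_nonneg
  calc c / (c + N + 1) * expCharNorm c s ≤ c / (c + N + 1) * 1 :=
        mul_le_mul_of_nonneg_left (expCharNorm_le_one hc s) (by positivity)
    _ ≤ expCharNorm c (s + N) := by
        rw [mul_one, expCharNorm]
        refine div_le_div_of_nonneg_left hc.le (by positivity) ?_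
        rw [Real.sqrt_le_left (by positivity)]
        nlinarith [mul_nonneg hc.le hN]

theorem not_integrable_prod_expCharNorm {m n : ℕ} {A : Matrix (Fin m) (Fin n) ℝ} {w : Fin n → ℝ}
    (hw : ∀ j, 0 < w j) {j : Fin n} {u : Fin m → ℝ} (huj : (u ⬝ᵥ fun l => A l j) = 1)
    (hu : ∀ k, k ≠ j → (u ⬝ᵥ fun l => A l k) = 0) :
    ¬ Integrable (fun η : Fin m → ℝ => ∏ j, expCharNorm (w j) (η ⬝ᵥ fun l => A l j)) volume := by
  intro hint
  set g : (Fin m → ℝ) → ℝ := fun η => ∏ j, expCharNorm (w j) (η ⬝ᵥ fun l => A l j) with hg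
  have hgpos : ∀ η, 0 < g η := fun η => Finset.prod_pos fun j _ => expCharNorm_pos (hw j) _
  -- Disjoint slabs of unit width; translation by `N • u` carries `S 0` onto `S N`.
  let S : ℕ → Set (Fin m → ℝ) := fun N =>
    {η | (η ⬝ᵥ fun l => A l j) ∈ Set.Ico (N : ℝ) (N + 1)}
  have hdot : Continuous fun η : Fin m → ℝ => η ⬝ᵥ fun l => A l j := by
    unfold dotProduct
    fun_prop
  have hSm : ∀ N, MeasurableSet (S N) := fun N => measurableSet_Ico.preimage hdot.measurable
  have hSd : Pairwise (Function.onFun Disjoint S) := by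
    intro N M hNM
    refine Set.disjoint_left.2 fun η hN hM => hNM ?_
    have h1 : (N : ℝ) < M + 1 := hN.1.trans_lt hM.2
    have h2 : (M : ℝ) < N + 1 := hM.1.trans_lt hN.2
    have h1' : N < M + 1 := by exact_mod_cast h1
    have h2' : M < N + 1 := by exact_mod_cast h2
    omega
  have hsum := (hasSum_integral_iUnion hSm hSd hint.integrableOn).summable
  have hpos : 0 < ∫ η in S 0, g η := by
    rw [setIntegral_pos_iff_support_of_nonneg_ae
      (Filter.Eventually.of_forall fun η => (hgpos η).le) hint.integrableOn]
    have hopen : IsOpen {η : Fin m → ℝ | (η ⬝ᵥ fun l => A l j) ∈ Set.Ioo (0 : ℝ) 1} :=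
      isOpen_Ioo.preimage hdot
    refine (hopen.measure_pos volume ⟨(1 / 2 : ℝ) • u, ?_⟩).trans_le (measure_mono ?_)
    · simp only [Set.mem_ofPred_eq, smul_dotProduct, huj]
      norm_num
    · intro η hη
      refine ⟨(hgpos η).ne', ?_⟩
      simp only [S, Set.mem_ofPred_eq, Nat.cast_zero, zero_add]
      exact Set.Ioo_subset_Ico_self hη
  have hshift : ∀ N : ℕ, ∫ η in S N, g η = ∫ η in S 0, g (η + (N : ℝ) • u) := by
    intro N
    rw [← (measurePreserving_add_right volume ((N : ℝ) • u)).setIntegral_preimage_emb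
      (measurableEmbedding_addRight _) g (S N)]
    congr 2
    ext η
    simp only [S, Set.mem_preimage, Set.mem_ofPred_eq, add_dotProduct, smul_dotProduct, huj,
      smul_eq_mul, mul_one, Set.mem_Ico, Nat.cast_zero, zero_add]
    constructor <;> rintro ⟨h1, h2⟩ <;> constructor <;> linarith
  have hbound : ∀ N : ℕ, w j / (w j + N + 1) * ∫ η in S 0, g η ≤ ∫ η in S N, g η := by
    intro N
    rw [hshift N, ← integral_const_mul]
    refine setIntegral_mono_on (hint.integrableOn.const_mul _)
      (hint.comp_add_right _).integrableOn (hSm 0) fun η hη => ?_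
    simp only [S, Set.mem_ofPred_eq, Nat.cast_zero, zero_add] at hη
    simp only [hg]
    rw [← Finset.mul_prod_erase _ _ (Finset.mem_univ j), ← mul_assoc,
      ← Finset.mul_prod_erase _ _ (Finset.mem_univ j)]
    have hrest : ∏ k ∈ Finset.univ.erase j,
          expCharNorm (w k) ((η + (N : ℝ) • u) ⬝ᵥ fun l => A l k)
        = ∏ k ∈ Finset.univ.erase j, expCharNorm (w k) (η ⬝ᵥ fun l => A l k) :=
      Finset.prod_congr rfl fun k hk => by
        rw [add_dotProduct, smul_dotProduct, hu k (Finset.ne_of_mem_erase hk), smul_zero, add_zero]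
    rw [hrest, add_dotProduct, smul_dotProduct, huj, smul_eq_mul, mul_one]
    exact mul_le_mul_of_nonneg_right (mul_expCharNorm_le_add (hw j) hη.1 hη.2 N)
      (Finset.prod_nonneg fun k _ => (expCharNorm_pos (hw k) _).le)
  have hsum' : Summable fun N : ℕ => w j / (w j + N + 1) * ∫ η in S 0, g η :=
    hsum.of_nonneg_of_le (fun N => by have := hw j; positivity) hbound
  -- The constant works because `w j + N + 1 ≤ (w j + 1) * (N + 1)`.
  have hsum'' : Summable fun N : ℕ => 1 / ((N : ℝ) + 1) := by
    have hc := hw j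
    refine ((summable_mul_right_iff hpos.ne').1 hsum' |>.mul_left ((w j + 1) / w j)).of_nonneg_of_le
      (fun N => by positivity) fun N => ?_
    rw [div_mul_div_comm, div_le_div_iff₀ (by positivity) (by positivity)]
    nlinarith [mul_nonneg (mul_nonneg hc.le hc.le) N.cast_nonneg (α := ℝ)]
  exact Real.not_summable_one_div_natCast
    ((summable_nat_add_iff 1).1 (by simpa using hsum''))

/-- Column `j` lies outside the span of the others, so a linear functional separates it from them;
`u` represents this functional, rescaled. -/
theorem exists_dual_of_rank_removeCol_ne {m n : ℕ} {A : Matrix (Fin m) (Fin n) ℝ} {j : Fin n}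
    (h : (removeCol A j).rank ≠ A.rank) :
    ∃ u : Fin m → ℝ, (u ⬝ᵥ fun l => A l j) = 1 ∧ ∀ k, k ≠ j → (u ⬝ᵥ fun l => A l k) = 0 := by
  rw [Ne, rank_removeCol_eq_iff_mem_span] at h
  obtain ⟨f, hf, hker⟩ := Submodule.exists_le_ker_of_notMem h
  have hdot : ∀ x : Fin m → ℝ, ((dotProductEquiv ℝ (Fin m)).symm f) ⬝ᵥ x = f x := fun x => by
    rw [← dotProductEquiv_apply_apply, LinearEquiv.apply_symm_apply]
  refine ⟨(f (A.col j))⁻¹ • (dotProductEquiv ℝ (Fin m)).symm f, ?_, fun k hk => ?_⟩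
  · rw [smul_dotProduct, hdot]
    exact inv_mul_cancel₀ hf
  · rw [smul_dotProduct, hdot]
    have : f (fun l => A l k) = 0 := hker (Submodule.subset_span ⟨⟨k, hk⟩, rfl⟩)
    rw [this, smul_zero]

theorem lemma5p2 {m n : ℕ} (A : Matrix (Fin m) (Fin n) ℝ) (b : Fin m → ℝ)
    (hrank : A.rank = m)
    (hcompact : IsCompact (polytope A b))
    (hrelint : (polytopeRelInterior A b).Nonempty)
    (w : Fin n → ℝ) (hw_span : ∃ u : Fin m → ℝ, w = u ᵥ* A) (hw_pos : ∀ j, 0 < w j) :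
    List.TFAE [
      Integrable (constraintCharFun A w) (volume : Measure (Fin m → ℝ)),
      ∀ j : Fin n, (removeCol A j).rank = A.rank,
      ∀ j : Fin n, (interior ((fun x : Fin n → ℝ => x j) '' polytope A b)).Nonempty] := by
  tfae_have 1 → 2 := by
    intro hint j
    by_contra hj
    obtain ⟨u, huj, hu⟩ := exists_dual_of_rank_removeCol_ne hj
    exact not_integrable_prod_expCharNorm hw_pos huj hu
      ((integrable_constraintCharFun_iff A hw_pos).1 hint)
  tfae_have 2 → 1 := fun h =>
    (integrable_constraintCharFun_iff A hw_pos).2 (integrable_prod_expCharNorm hw_pos hrank h)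
  tfae_have 2 ↔ 3 := forall_congr' fun j => by
    rw [rank_removeCol_eq_iff_exists_ker, nonempty_interior_image_polytope_iff A b hrelint]
  tfae_finish
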